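/- Let $E$ and $E_*$ be complex Hilbert spaces. For a complex Hilbert space $X$, let $H^2_X(\mathbb{D})$ be the $X$-valued Hardy space on the open unit disc $\mathbb{D}$, i.e. the Hilbert space of power series $f(z)=\sum_{n\ge 0} z^n a_n$ with $a_n\in X$ and $\|f\|^2=\sum_n\|a_n\|^2<\infty$. For a bounded analytic function $\Phi:\mathbb{D}\to B(X,Y)$, let $M_\Phi:H^2_X(\mathbb{D})\to H^2_Y(\mathbb{D})$, $(M_\Phi f)(z)=\Phi(z)f(z)$, be the multiplication operator (the analytic Toeplitz operator with symbol $\Phi$); $\Phi$ is called inner if $M_\Phi$ is an isometry. Theorem. Let $\Theta:\mathbb{D}\to B(E,E_*)$ be a bounded analytic inner function, let $\mathcal{S}=M_\Theta H^2_E(\mathbb{D})$ be the corresponding (closed, $M_z$-invariant) subspace of $H^2_{E_*}(\mathbb{D})$, assume $\mathcal{S}\neq\{0\}$, and let $A\in B(E_*)$. Then $\mathcal{S}$ is invariant under the analytic Toeplitz operator with symbol $A+A^*z$ if and only if there exists a unique operator $B\in B(E)$ such that $$(A+A^*z)\,\Theta(z)=\Theta(z)\,(B+B^*z)\qquad\text{for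 all } z\in\mathbb{D}.$$ -/

import Mathlib

open Metric MeasureTheory
open scoped ENNReal InnerProductSpace

namespace OperatorHardy

noncomputable section

section HardySpace

variable {E F : Type*} [NormedAddCommGroup E] [InnerProductSpace ℂ E]
  [NormedAddCommGroup F] [InnerProductSpace ℂ F]

/-- The `E`-valued Hardy space `H²_E(𝔻)`: the Hilbert space of power series `∑ zⁿ aₙ` with
coefficients `aₙ` in `E` and `‖f‖² = ∑ ‖aₙ‖² < ∞`. An element is stored as its sequence of
Taylor coefficients; the analytic function on the disc is `eval f`. -/
abbrev H2 (E : Type*) [NormedAddCommGroup E] [InnerProductSpace ℂ E] : Type _ :=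
  lp (fun _ : ℕ => E) 2

/-- The value `f(z) = ∑ zⁿ aₙ` of `f ∈ H²_E(𝔻)` at a point `z` of the open unit disc. -/
def eval (f : H2 E) (z : ℂ) : E := ∑' n : ℕ, z ^ n • f n

/-- The space `H^∞_{B(E,F)}(𝔻)` of bounded analytic functions on the open unit disc with values
in `B(E,F)`. The values of `toFun` off the disc play no role. -/
structure HInfty (E F : Type*) [NormedAddCommGroup E] [InnerProductSpace ℂ E]
    [NormedAddCommGroup F] [InnerProductSpace ℂ F] where
  toFun : ℂ → E →L[ℂ] F
  differentiableOn : DifferentiableOn ℂ toFun (ball 0 1)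
  bounded : ∃ C : ℝ, ∀ z ∈ ball (0 : ℂ) 1, ‖toFun z‖ ≤ C

instance : CoeFun (HInfty E F) (fun _ => ℂ → E →L[ℂ] F) := ⟨HInfty.toFun⟩

/-! Facts needed to see that a function in `H^∞` multiplies `H²` into `H²`. -/

theorem hasSum_norm_sq (f : H2 E) : HasSum (fun n => ‖f n‖ ^ 2) (‖f‖ ^ 2) := by
  have := lp.hasSum_norm (p := 2) (by norm_num) f
  simpa using this

theorem summable_norm_eval (f : H2 E) {r : ℝ} (h0 : 0 ≤ r) (h1 : r < 1) :
    Summable fun n : ℕ => r ^ n * ‖f n‖ :=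
  Summable.of_nonneg_of_le (fun n => by positivity)
    (fun n => mul_le_mul_of_nonneg_left (lp.norm_apply_le_norm (by norm_num) f n) (by positivity))
    ((summable_geometric_of_lt_one h0 h1).mul_right ‖f‖)

theorem hasSum_eval [CompleteSpace E] (f : H2 E) {z : ℂ} (hz : z ∈ ball (0 : ℂ) 1) :
    HasSum (fun n : ℕ => z ^ n • f n) (eval f z) := by
  refine Summable.hasSum (Summable.of_norm ?_)
  have := summable_norm_eval f (norm_nonneg z) (by simpa using hz)
  simpa [norm_smul] using this

theorem eval_add [CompleteSpace E] (f g : H2 E) {z : ℂ} (hz : z ∈ ball (0 : ℂ) 1) :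
    eval (f + g) z = eval f z + eval g z := by
  refine HasSum.tsum_eq ?_
  simpa [smul_add] using (hasSum_eval f hz).add (hasSum_eval g hz)

theorem eval_smul [CompleteSpace E] (c : ℂ) (f : H2 E) {z : ℂ} (hz : z ∈ ball (0 : ℂ) 1) :
    eval (c • f) z = c • eval f z := by
  refine HasSum.tsum_eq ?_
  simpa [smul_comm c] using (hasSum_eval f hz).const_smul c

theorem differentiableOn_eval [CompleteSpace E] (f : H2 E) :
    DifferentiableOn ℂ (eval f) (ball 0 1) := by
  intro z hz
  obtain ⟨r, hzr, hr1⟩ := exists_between (show ‖z‖ < 1 by simpa using hz)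
  have h0 : 0 ≤ r := (norm_nonneg z).trans hzr.le
  have : DifferentiableOn ℂ (eval f) (ball 0 r) := by
    refine Complex.differentiableOn_tsum_of_summable_norm (summable_norm_eval f h0 hr1)
      (fun n => by fun_prop) isOpen_ball ?_
    intro n w hw
    rw [norm_smul, norm_pow]
    have : ‖w‖ ≤ r := by simpa using (mem_ball_zero_iff.1 hw).le
    gcongr
  exact (this.differentiableAt (isOpen_ball.mem_nhds (by simpa using hzr))).differentiableWithinAt

local instance : Fact (0 < 2 * Real.pi) := ⟨Real.two_pi_pos⟩

/-- The absolutely convergent trigonometric series with coefficients `a`. -/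
def trigSeries (a : ℕ → E) (t : AddCircle (2 * Real.pi)) : E := ∑' n : ℕ, fourier (n : ℤ) t • a n

theorem norm_fourier_apply (n : ℤ) (t : AddCircle (2 * Real.pi)) : ‖fourier n t‖ = 1 := by
  rw [fourier_apply, Circle.norm_coe]

theorem continuous_trigSeries [CompleteSpace E] {a : ℕ → E} (ha : Summable fun n => ‖a n‖) :
    Continuous (trigSeries a) :=
  continuous_tsum (fun n => by fun_prop) ha (fun n t => by
    rw [norm_smul, norm_fourier_apply, one_mul])

theorem fourierCoeff_trigSeries [CompleteSpace E] {a : ℕ → E} (ha : Summable fun n => ‖a n‖)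
    (m : ℕ) : fourierCoeff (trigSeries a) m = a m := by
  have key := hasSum_integral_of_summable_integral_norm
    (μ := AddCircle.haarAddCircle (T := 2 * Real.pi))
    (F := fun (n : ℕ) t => fourier (-(m : ℤ)) t • fourier (n : ℤ) t • a n)
    (fun n => Continuous.integrable_of_hasCompactSupport (by fun_prop)
      (HasCompactSupport.of_compactSpace _))
    (by simpa only [norm_smul, norm_fourier_apply, one_mul, integral_const, probReal_univ,
      one_smul] using ha)
  have h1 : ∀ n : ℕ, ∫ t, fourier (-(m : ℤ)) t • fourier (n : ℤ) t • a n
      ∂AddCircle.haarAddCircle (T := 2 * Real.pi) = if n = m then a m else 0 := by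
    intro n
    have h2 := congrFun (fourierCoeff_fourier (T := 2 * Real.pi) (n : ℤ)) m
    simp only [fourierCoeff] at h2
    simp only [← smul_assoc]
    rw [integral_smul_const, h2]
    by_cases h : n = m
    · subst h; simp
    · have h' : (m : ℤ) ≠ n := by exact_mod_cast Ne.symm h
      simp [h]
  simp only [h1] at key
  have h3 := key.unique (hasSum_ite_eq m (a m))
  rw [← h3, fourierCoeff]
  refine integral_congr_ae (Filter.Eventually.of_forall fun t => ?_)
  have hs : Summable fun n : ℕ => fourier (n : ℤ) t • a n :=
    Summable.of_norm (by simpa only [norm_smul, norm_fourier_apply, one_mul] using ha)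
  simp only [trigSeries]
  exact (hs.tsum_const_smul _).symm

/-- Parseval's identity for absolutely convergent series. -/
theorem integral_norm_sq_trigSeries [CompleteSpace E] {a : ℕ → E}
    (ha : Summable fun n => ‖a n‖) :
    ∫ t, ‖trigSeries a t‖ ^ 2 ∂AddCircle.haarAddCircle (T := 2 * Real.pi)
      = ∑' n, ‖a n‖ ^ 2 := by
  have hc := continuous_trigSeries ha
  have hint : ∀ {g : AddCircle (2 * Real.pi) → E}, Continuous g →
      Integrable g (AddCircle.haarAddCircle (T := 2 * Real.pi)) := fun hg =>
    Continuous.integrable_of_hasCompactSupport hg (HasCompactSupport.of_compactSpace _)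
  obtain ⟨K, hK⟩ : ∃ K, ∀ t, ‖trigSeries a t‖ ≤ K := by
    obtain ⟨K, hK⟩ := (isCompact_range hc).isBounded.exists_norm_le
    exact ⟨K, fun t => hK _ ⟨t, rfl⟩⟩
  have hFc : ∀ n : ℕ, Continuous fun t => ⟪a n, fourier (-(n : ℤ)) t • trigSeries a t⟫_ℂ :=
    fun n => by fun_prop
  have key := hasSum_integral_of_summable_integral_norm
    (μ := AddCircle.haarAddCircle (T := 2 * Real.pi))
    (F := fun (n : ℕ) t => ⟪a n, fourier (-(n : ℤ)) t • trigSeries a t⟫_ℂ)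
    (fun n => Continuous.integrable_of_hasCompactSupport (hFc n)
      (HasCompactSupport.of_compactSpace _))
    (by
      refine Summable.of_nonneg_of_le (fun n => integral_nonneg fun t => norm_nonneg _)
        (fun n => ?_) (ha.mul_right K)
      have : ∀ t, ‖⟪a n, fourier (-(n : ℤ)) t • trigSeries a t⟫_ℂ‖ ≤ ‖a n‖ * K := fun t => by
        refine (norm_inner_le_norm _ _).trans ?_
        rw [norm_smul, norm_fourier_apply, one_mul]
        exact mul_le_mul_of_nonneg_left (hK t) (norm_nonneg _)
      refine (integral_mono (Continuous.integrable_of_hasCompactSupport (hFc n).norm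
        (HasCompactSupport.of_compactSpace _)) (integrable_const _) this).trans ?_
      simp)
  have h1 : ∀ n : ℕ, ∫ t, ⟪a n, fourier (-(n : ℤ)) t • trigSeries a t⟫_ℂ
      ∂AddCircle.haarAddCircle (T := 2 * Real.pi) = ((‖a n‖ ^ 2 : ℝ) : ℂ) := by
    intro n
    rw [integral_inner (hint (by fun_prop))]
    have := fourierCoeff_trigSeries ha n
    rw [fourierCoeff] at this
    rw [this, inner_self_eq_norm_sq_to_K]
    norm_cast
  have h2 : ∀ t, ∑' n : ℕ, ⟪a n, fourier (-(n : ℤ)) t • trigSeries a t⟫_ℂ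
      = ((‖trigSeries a t‖ ^ 2 : ℝ) : ℂ) := by
    intro t
    have hs : HasSum (fun n : ℕ => fourier (n : ℤ) t • a n) (trigSeries a t) :=
      (Summable.of_norm (by simpa only [norm_smul, norm_fourier_apply, one_mul] using ha)).hasSum
    have h3 := (((innerSL ℂ (trigSeries a t)).hasSum hs).star).tsum_eq
    simp only [innerSL_apply_apply] at h3
    have h4 : ∀ n : ℕ, star ⟪trigSeries a t, fourier (n : ℤ) t • a n⟫_ℂ
        = ⟪a n, fourier (-(n : ℤ)) t • trigSeries a t⟫_ℂ := by
      intro n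
      rw [inner_smul_right, inner_smul_right, star_mul', fourier_neg]
      congr 1
      exact inner_conj_symm _ _
    simp only [h4] at h3
    rw [h3, inner_self_eq_norm_sq_to_K]
    simp
  simp only [h1, h2] at key
  rw [integral_complex_ofReal] at key
  exact ((Complex.hasSum_ofReal.1 key).tsum_eq).symm

theorem tsum_norm_sq_le_of_trigSeries_le [CompleteSpace E] [CompleteSpace F] {a : ℕ → E}
    {b : ℕ → F} (ha : Summable fun n => ‖a n‖) (hb : Summable fun n => ‖b n‖) {C : ℝ}
    (h : ∀ t, ‖trigSeries b t‖ ≤ C * ‖trigSeries a t‖) :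
    ∑' n, ‖b n‖ ^ 2 ≤ C ^ 2 * ∑' n, ‖a n‖ ^ 2 := by
  rw [← integral_norm_sq_trigSeries ha, ← integral_norm_sq_trigSeries hb, ← integral_const_mul]
  have hca := continuous_trigSeries ha
  have hcb := continuous_trigSeries hb
  refine integral_mono
    (Continuous.integrable_of_hasCompactSupport (by fun_prop) (HasCompactSupport.of_compactSpace _))
    (Continuous.integrable_of_hasCompactSupport (by fun_prop) (HasCompactSupport.of_compactSpace _))
    fun t => ?_
  simp only [← mul_pow]
  gcongr
  exact h t

theorem trigSeries_eq_of_hasSum {g : ℂ → E} {b : ℕ → E}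
    (hg : ∀ z ∈ ball (0 : ℂ) 1, HasSum (fun n : ℕ => z ^ n • b n) (g z)) {r : ℝ} (h0 : 0 ≤ r)
    (h1 : r < 1) (t : AddCircle (2 * Real.pi)) :
    trigSeries (fun n => ((r : ℂ) ^ n) • b n) t = g (r * fourier 1 t) := by
  have hz : (r * fourier 1 t : ℂ) ∈ ball (0 : ℂ) 1 := by
    rw [mem_ball_zero_iff, norm_mul, norm_fourier_apply]
    simpa [abs_of_nonneg h0] using h1
  rw [← (hg _ hz).tsum_eq, trigSeries]
  refine tsum_congr fun n => ?_
  rw [smul_smul, mul_pow, mul_comm]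
  congr 2
  rw [fourier_apply, fourier_apply, one_smul, natCast_zsmul, AddCircle.toCircle_nsmul,
    Circle.coe_pow]

theorem summable_of_hasSum {g : ℂ → E} {b : ℕ → E}
    (hg : ∀ z ∈ ball (0 : ℂ) 1, HasSum (fun n : ℕ => z ^ n • b n) (g z)) {r : ℝ} (h0 : 0 ≤ r)
    (h1 : r < 1) : Summable fun n => ‖((r : ℂ) ^ n) • b n‖ := by
  obtain ⟨s, hrs, hs1⟩ := exists_between h1
  have hs0 : 0 < s := h0.trans_lt hrs
  have hsum := (hg (s : ℂ) (by simpa [abs_of_pos hs0] using hs1)).summable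
  obtain ⟨K, hK⟩ := hsum.tendsto_atTop_zero.norm.bddAbove_range
  have hK' : ∀ n, s ^ n * ‖b n‖ ≤ K := fun n => by
    have := hK ⟨n, rfl⟩
    simpa [norm_smul, abs_of_pos hs0] using this
  refine Summable.of_nonneg_of_le (fun n => norm_nonneg _) (fun n => ?_)
    ((summable_geometric_of_lt_one (div_nonneg h0 hs0.le) ((div_lt_one hs0).2 hrs)).mul_right K)
  have : ‖((r : ℂ) ^ n) • b n‖ = (r / s) ^ n * (s ^ n * ‖b n‖) := by
    rw [norm_smul, ← mul_assoc, ← mul_pow, div_mul_cancel₀ _ hs0.ne']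
    simp [abs_of_nonneg h0]
  rw [this]
  exact mul_le_mul_of_nonneg_left (hK' n) (by positivity)

/-- Every function in `H^∞_{B(E,F)}(𝔻)` is a multiplier from `H²_E(𝔻)` into `H²_F(𝔻)`. -/
theorem exists_mul [CompleteSpace E] [CompleteSpace F] (Φ : HInfty E F) {C : ℝ}
    (hC : ∀ z ∈ ball (0 : ℂ) 1, ‖Φ z‖ ≤ C) (f : H2 E) :
    ∃ g : H2 F, ‖g‖ ≤ C * ‖f‖ ∧ ∀ z ∈ ball (0 : ℂ) 1, eval g z = Φ z (eval f z) := by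
  have hC0 : 0 ≤ C := (norm_nonneg _).trans (hC 0 (by simp))
  set G : ℂ → F := fun z => Φ z (eval f z) with hG
  have hGd : DifferentiableOn ℂ G (ball 0 1) :=
    Φ.differentiableOn.clm_apply (differentiableOn_eval f)
  set b : ℕ → F := fun n => ((n.factorial : ℂ)⁻¹) • iteratedDeriv n G 0 with hb
  have hGs : ∀ z ∈ ball (0 : ℂ) 1, HasSum (fun n : ℕ => z ^ n • b n) (G z) := by
    intro z hz
    have := Complex.hasSum_taylorSeries_on_ball hGd hz
    simp only [sub_zero] at this
    refine this.congr_fun ?_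
    intro n
    simp only [hb]
    rw [smul_comm]
  have hfin : ∀ s : Finset ℕ, ∑ n ∈ s, ‖b n‖ ^ 2 ≤ (C * ‖f‖) ^ 2 := by
    intro s
    have hr : ∀ r ∈ Set.Ico (0 : ℝ) 1, ∑ n ∈ s, (r ^ n * ‖b n‖) ^ 2 ≤ (C * ‖f‖) ^ 2 := by
      rintro r ⟨h0, h1⟩
      have hsb := summable_of_hasSum hGs h0 h1
      have hsf := summable_of_hasSum (fun z hz => hasSum_eval f hz) h0 h1
      have hle := tsum_norm_sq_le_of_trigSeries_le (C := C) hsf hsb (fun t => by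
        rw [trigSeries_eq_of_hasSum hGs h0 h1,
          trigSeries_eq_of_hasSum (fun z hz => hasSum_eval f hz) h0 h1]
        refine (ContinuousLinearMap.le_opNorm _ _).trans
          (mul_le_mul_of_nonneg_right (hC _ ?_) (norm_nonneg _))
        rw [mem_ball_zero_iff, norm_mul, norm_fourier_apply]
        simpa [abs_of_nonneg h0] using h1)
      have hn : ∀ (n : ℕ) (v : F),
          ‖((r : ℂ) ^ n) • v‖ = r ^ n * ‖v‖ := fun n v => by
        simp [norm_smul, abs_of_nonneg h0]
      have hn2 : ∀ (n : ℕ) (v : E), ‖((r : ℂ) ^ n) • v‖ ≤ ‖v‖ := fun n v => by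
        rw [norm_smul, norm_pow, Complex.norm_real, Real.norm_of_nonneg h0]
        exact mul_le_of_le_one_left (norm_nonneg _) (pow_le_one₀ h0 h1.le)
      have hsq : ∀ {c : ℕ → ℝ}, (∀ n, 0 ≤ c n) → Summable c → Summable fun n => c n ^ 2 := by
        intro c hc0 hc
        obtain ⟨K, hK⟩ := hc.tendsto_atTop_zero.bddAbove_range
        refine Summable.of_nonneg_of_le (fun n => sq_nonneg _) (fun n => ?_) (hc.mul_left K)
        rw [sq]
        exact mul_le_mul_of_nonneg_right (hK ⟨n, rfl⟩) (hc0 n)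
      calc ∑ n ∈ s, (r ^ n * ‖b n‖) ^ 2 = ∑ n ∈ s, ‖((r : ℂ) ^ n) • b n‖ ^ 2 := by
            simp only [hn]
        _ ≤ ∑' n, ‖((r : ℂ) ^ n) • b n‖ ^ 2 :=
            (hsq (fun n => norm_nonneg _) hsb).sum_le_tsum s (fun n _ => sq_nonneg _)
        _ ≤ C ^ 2 * ∑' n, ‖((r : ℂ) ^ n) • f n‖ ^ 2 := hle
        _ ≤ C ^ 2 * ‖f‖ ^ 2 := by
            rw [← (hasSum_norm_sq f).tsum_eq]
            refine mul_le_mul_of_nonneg_left ?_ (sq_nonneg _)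
            exact (hsq (fun n => norm_nonneg _) hsf).tsum_le_tsum
              (fun n => pow_le_pow_left₀ (norm_nonneg _) (hn2 n _) 2)
              (hasSum_norm_sq f).summable
        _ = (C * ‖f‖) ^ 2 := by ring
    have hcont : Filter.Tendsto (fun r : ℝ => ∑ n ∈ s, (r ^ n * ‖b n‖) ^ 2)
        (nhdsWithin 1 (Set.Iio 1)) (nhds (∑ n ∈ s, ((1 : ℝ) ^ n * ‖b n‖) ^ 2)) :=
      (Continuous.tendsto (by fun_prop) 1).mono_left nhdsWithin_le_nhds
    have := le_of_tendsto hcont (by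
      filter_upwards [Ico_mem_nhdsLT (show (0 : ℝ) < 1 by norm_num)] with r hr' using hr r hr')
    simpa using this
  have hmem : Memℓp b 2 := memℓp_gen' (C := (C * ‖f‖) ^ 2) (by simpa using hfin)
  refine ⟨⟨b, hmem⟩, ?_, fun z hz => (hGs z hz).tsum_eq⟩
  exact lp.norm_le_of_forall_sum_le (by norm_num) (by positivity) (by simpa using hfin)

/-- An element of `H²_E(𝔻)` is determined by its values on the disc. -/
theorem ext_eval [CompleteSpace E] {f g : H2 E}
    (h : ∀ z ∈ ball (0 : ℂ) 1, eval f z = eval g z) : f = g := by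
  have h0 : (0 : ℝ) ≤ 1 / 2 := by norm_num
  have h1 : (1 / 2 : ℝ) < 1 := by norm_num
  have hf := fun z (hz : z ∈ ball (0 : ℂ) 1) => hasSum_eval f hz
  have hg := fun z (hz : z ∈ ball (0 : ℂ) 1) => hasSum_eval g hz
  have hg' : ∀ z ∈ ball (0 : ℂ) 1, HasSum (fun n : ℕ => z ^ n • g n) (eval f z) :=
    fun z hz => by rw [h z hz]; exact hg z hz
  ext n
  have e1 := fourierCoeff_trigSeries (summable_of_hasSum hf h0 h1) n
  have e2 := fourierCoeff_trigSeries (summable_of_hasSum hg' h0 h1) n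
  have e3 : trigSeries (fun n => (((1 / 2 : ℝ) : ℂ) ^ n) • f n)
      = trigSeries (fun n => (((1 / 2 : ℝ) : ℂ) ^ n) • g n) := by
    funext t
    rw [trigSeries_eq_of_hasSum hf h0 h1, trigSeries_eq_of_hasSum hg' h0 h1]
  rw [e3, e2] at e1
  exact (smul_right_injective E (r := (((1 / 2 : ℝ) : ℂ) ^ n)) (by simp) e1).symm

variable [CompleteSpace E] [CompleteSpace F]

theorem exists_mulOp (Φ : HInfty E F) :
    ∃ T : H2 E →L[ℂ] H2 F, ∀ f, ∀ z ∈ ball (0 : ℂ) 1, eval (T f) z = Φ z (eval f z) := by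
  obtain ⟨C, hC⟩ := Φ.bounded
  choose T hT hev using exists_mul Φ hC
  refine ⟨LinearMap.mkContinuous
    { toFun := T
      map_add' := fun f g => ext_eval fun z hz => by
        rw [eval_add _ _ hz, hev _ z hz, hev _ z hz, hev _ z hz, eval_add _ _ hz, map_add]
      map_smul' := fun c f => ext_eval fun z hz => by
        rw [RingHom.id_apply, eval_smul _ _ hz, hev _ z hz, hev _ z hz, eval_smul _ _ hz, map_smul] }
    C hT, hev⟩

/-- The multiplication operator `M_Φ : H²_E(𝔻) → H²_F(𝔻)`, `(M_Φ f)(z) = Φ(z) f(z)`, of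
`Φ ∈ H^∞_{B(E,F)}(𝔻)`; it is also called the analytic Toeplitz operator with symbol `Φ`. -/
def mulOp (Φ : HInfty E F) : H2 E →L[ℂ] H2 F := (exists_mulOp Φ).choose

/-- The property that characterizes `M_Φ` (uniquely, by `ext_eval`). -/
theorem eval_mulOp (Φ : HInfty E F) (f : H2 E) {z : ℂ} (hz : z ∈ ball (0 : ℂ) 1) :
    eval (mulOp Φ f) z = Φ z (eval f z) :=
  (exists_mulOp Φ).choose_spec f z hz

/-- `Θ ∈ H^∞_{B(E,F)}(𝔻)` is inner if `M_Θ` is an isometry. -/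
def IsInner (Θ : HInfty E F) : Prop := Isometry (mulOp Θ)

/-- The analytic polynomial symbol `A + A* z`. -/
def linearSymbol (A : E →L[ℂ] E) : HInfty E E where
  toFun z := A + z • ContinuousLinearMap.adjoint A
  differentiableOn := by fun_prop
  bounded := by
    refine ⟨‖A‖ + ‖ContinuousLinearMap.adjoint A‖, fun z hz => ?_⟩
    refine (norm_add_le _ _).trans (add_le_add_right ?_ _)
    rw [norm_smul]
    exact mul_le_of_le_one_left (norm_nonneg _) (mem_ball_zero_iff.1 hz).le

end HardySpace

end

end OperatorHardy

namespace OperatorHardy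

open ContinuousLinearMap

/-! Let `T` be multiplication by `A + A^* z`. It commutes with the shift `M_z`, and `T^* M_z = T`
because `M_z` is an isometry commuting with constant symbols. If the range of `M_Θ` is
`T`-invariant, then `X = M_Θ^* T M_Θ` satisfies `M_Θ X = T M_Θ`, and since `M_Θ` is an isometry
commuting with shifts, `X` inherits both identities. They force `X e = B e + z B^* e` on constants
`e` (`exists_eval_single_zero_eq_linearSymbol`), where `B e` is the value of `X e` at `0`.
Evaluating `M_Θ X e = T M_Θ e` pointwise gives the factorization. Uniqueness is injectivity of
`M_Θ`; the converse is pointwise. -/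

theorem eval_single_zero {E : Type*} [NormedAddCommGroup E] [InnerProductSpace ℂ E] (e : E)
    (z : ℂ) : eval (lp.single 2 0 e : H2 E) z = e := by
  rw [eval, tsum_eq_single 0]
  · simp
  · intro n hn
    simp [lp.single_apply, hn]

variable {E F : Type*} [NormedAddCommGroup E] [InnerProductSpace ℂ E] [CompleteSpace E]
  [NormedAddCommGroup F] [InnerProductSpace ℂ F] [CompleteSpace F]

/-- The Taylor coefficients of an element of `H²` are determined by its values on the disc. -/
theorem apply_eq_of_hasSum_eval {g : H2 E} {b : ℕ → E}
    (h : ∀ z ∈ ball (0 : ℂ) 1, HasSum (fun n : ℕ => z ^ n • b n) (eval g z)) (n : ℕ) :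
    g n = b n := by
  -- Any radius in `(0, 1)` would do: below `1` for absolute convergence on the circle, nonzero so
  -- that its powers cancel at the end.
  have h0 : (0 : ℝ) ≤ 1 / 2 := by norm_num
  have h1 : (1 / 2 : ℝ) < 1 := by norm_num
  have hg := fun z (hz : z ∈ ball (0 : ℂ) 1) => hasSum_eval g hz
  have e1 := fourierCoeff_trigSeries (summable_of_hasSum hg h0 h1) n
  have e2 := fourierCoeff_trigSeries (summable_of_hasSum h h0 h1) n
  have e3 : trigSeries (fun n => (((1 / 2 : ℝ) : ℂ) ^ n) • g n)
      = trigSeries (fun n => (((1 / 2 : ℝ) : ℂ) ^ n) • b n) := by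
    funext t
    rw [trigSeries_eq_of_hasSum hg h0 h1, trigSeries_eq_of_hasSum h h0 h1]
  rw [e3, e2] at e1
  exact (smul_right_injective E (r := (((1 / 2 : ℝ) : ℂ) ^ n)) (by simp) e1).symm

/-! ### Constant symbols and the shift on Taylor coefficients -/

/-- The constant symbol `A`. -/
def constSymbol (A : E →L[ℂ] F) : HInfty E F where
  toFun _ := A
  differentiableOn := by fun_prop
  bounded := ⟨‖A‖, fun _ _ => le_rfl⟩

variable (E) in
/-- The symbol `z`. -/
def zSymbol : HInfty E E where
  toFun z := z • ContinuousLinearMap.id ℂ E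
  differentiableOn := by fun_prop
  bounded := by
    refine ⟨‖ContinuousLinearMap.id ℂ E‖, fun z hz => ?_⟩
    rw [norm_smul]
    exact mul_le_of_le_one_left (norm_nonneg _) (mem_ball_zero_iff.1 hz).le

variable (E) in
/-- The shift `M_z`. -/
noncomputable abbrev shift : H2 E →L[ℂ] H2 E := mulOp (zSymbol E)

theorem eval_shift (f : H2 E) {z : ℂ} (hz : z ∈ ball (0 : ℂ) 1) :
    eval (shift E f) z = z • eval f z := by
  simp [eval_mulOp _ _ hz, zSymbol]

theorem eval_mulOp_constSymbol (A : E →L[ℂ] F) (f : H2 E) {z : ℂ} (hz : z ∈ ball (0 : ℂ) 1) :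
    eval (mulOp (constSymbol A) f) z = A (eval f z) := by
  simp [eval_mulOp _ _ hz, constSymbol]

theorem mulOp_constSymbol_apply (A : E →L[ℂ] F) (f : H2 E) (n : ℕ) :
    mulOp (constSymbol A) f n = A (f n) := by
  refine apply_eq_of_hasSum_eval (b := fun n => A (f n)) (fun z hz => ?_) n
  rw [eval_mulOp_constSymbol A f hz]
  simpa using A.hasSum (hasSum_eval f hz)

/-- Multiplication by `z` prepends a zero coefficient; this expansion lets `apply_eq_of_hasSum_eval`
read off the coefficients. -/
theorem hasSum_eval_shift (f : H2 E) {z : ℂ} (hz : z ∈ ball (0 : ℂ) 1) :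
    HasSum (fun n : ℕ => z ^ n • (n.casesOn 0 f : E)) (eval (shift E f) z) := by
  rw [eval_shift f hz, ← hasSum_nat_add_iff' 1]
  simpa [pow_succ', mul_smul] using (hasSum_eval f hz).const_smul z

theorem shift_apply_zero (f : H2 E) : shift E f 0 = 0 :=
  apply_eq_of_hasSum_eval (fun _ hz => hasSum_eval_shift f hz) 0

theorem shift_apply_succ (f : H2 E) (n : ℕ) : shift E f (n + 1) = f n :=
  apply_eq_of_hasSum_eval (fun _ hz => hasSum_eval_shift f hz) (n + 1)

theorem inner_shift_shift (f g : H2 E) : ⟪shift E f, shift E g⟫_ℂ = ⟪f, g⟫_ℂ := by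
  have h := (lp.summable_inner (𝕜 := ℂ) (shift E f) (shift E g)).tsum_eq_zero_add
  simp only [shift_apply_zero, shift_apply_succ, inner_zero_left, zero_add] at h
  rw [lp.inner_eq_tsum, lp.inner_eq_tsum, ← h]

theorem shift_single (n : ℕ) (e : E) : shift E (lp.single 2 n e) = lp.single 2 (n + 1) e := by
  ext k
  cases k with
  | zero => simp [shift_apply_zero, lp.single_apply]
  | succ k => simp [shift_apply_succ, lp.single_apply, Pi.single_apply]

theorem inner_mulOp_constSymbol_left (A : E →L[ℂ] E) (f g : H2 E) :
    ⟪mulOp (constSymbol A) f, g⟫_ℂ = ⟪f, mulOp (constSymbol (adjoint A)) g⟫_ℂ := by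
  simp only [lp.inner_eq_tsum, mulOp_constSymbol_apply, adjoint_inner_right]

/-! ### Algebra of the symbol `A + A^* z` -/

theorem mulOp_shift (Φ : HInfty E F) (f : H2 E) :
    mulOp Φ (shift E f) = shift F (mulOp Φ f) :=
  ext_eval fun z hz => by
    rw [eval_mulOp _ _ hz, eval_shift _ hz, eval_shift _ hz, eval_mulOp _ _ hz, map_smul]

theorem mulOp_linearSymbol (A : E →L[ℂ] E) (f : H2 E) :
    mulOp (linearSymbol A) f =
      mulOp (constSymbol A) f + shift E (mulOp (constSymbol (adjoint A)) f) :=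
  ext_eval fun z hz => by
    rw [eval_mulOp _ _ hz, eval_add _ _ hz, eval_shift _ hz, eval_mulOp_constSymbol _ _ hz,
      eval_mulOp_constSymbol _ _ hz]
    simp [linearSymbol]

/-- The identity `T^* M_z = T` for the Toeplitz operator `T` with symbol `A + A^* z`. -/
theorem inner_mulOp_linearSymbol (A : E →L[ℂ] E) (f g : H2 E) :
    ⟪mulOp (linearSymbol A) f, g⟫_ℂ = ⟪shift E f, mulOp (linearSymbol A) g⟫_ℂ := by
  -- The two summands match crosswise: the `A` term on the left with the `A^*` term on the right,
  -- and vice versa.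
  rw [mulOp_linearSymbol, mulOp_linearSymbol, inner_add_left, inner_add_right, inner_shift_shift,
    inner_mulOp_constSymbol_left, ← mulOp_shift, inner_mulOp_constSymbol_left, adjoint_adjoint,
    add_comm]

/-- An operator `X` on `H²` commuting with the shift `M_z` and satisfying `X^* M_z = X` is, on
constant functions, multiplication by `B + B^* z`. -/
theorem exists_eval_single_zero_eq_linearSymbol (X : H2 E →L[ℂ] H2 E)
    (hX : ∀ f, X (shift E f) = shift E (X f))
    (hXs : ∀ f g, ⟪X f, g⟫_ℂ = ⟪shift E f, X g⟫_ℂ) :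
    ∃ B : E →L[ℂ] E, ∀ e z, eval (X (lp.single 2 0 e)) z = linearSymbol B z e := by
  -- Apply `X^* M_z = X`, then cancel the shift on both sides; pairing with a constant sees only the
  -- zeroth coefficient.
  have key : ∀ (e : E) (h : H2 E), ⟪X (lp.single 2 0 e), shift E h⟫_ℂ = ⟪e, X h 0⟫_ℂ := by
    intro e h
    rw [hXs, hX, inner_shift_shift, lp.inner_single_left]
  let B : E →L[ℂ] E := lp.evalCLM ℂ (fun _ : ℕ => E) 2 0 ∘L X ∘L
    lp.singleContinuousLinearMap ℂ (fun _ : ℕ => E) 2 0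
  have hB : ∀ e, X (lp.single 2 0 e) 0 = B e := fun e => rfl
  have h1 : ∀ e, X (lp.single 2 0 e) 1 = adjoint B e := fun e => by
    refine ext_inner_right ℂ fun g => ?_
    rw [← lp.inner_single_right, ← shift_single 0, key, hB, adjoint_inner_left]
  -- Here the vector `h` in `key` is itself a shift, so `X h` vanishes at `0`.
  have h2 : ∀ e n, X (lp.single 2 0 e) (n + 2) = 0 := fun e n => by
    refine ext_inner_right ℂ fun g => ?_
    rw [← lp.inner_single_right, ← shift_single, key, ← shift_single, hX, shift_apply_zero,
      inner_zero_right, inner_zero_left]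
  refine ⟨B, fun e z => ?_⟩
  rw [eval, tsum_eq_sum (s := Finset.range 2)]
  · simp [Finset.sum_range_succ, hB, h1, linearSymbol]
  · intro n hn
    obtain ⟨k, rfl⟩ := Nat.exists_eq_add_of_le' (not_lt.1 (Finset.mem_range.not.1 hn))
    rw [h2, smul_zero]

/-! ### Inner symbols: existence and uniqueness of `B` -/

theorem IsInner.inner_mulOp {Θ : HInfty E F} (hΘ : IsInner Θ) (f g : H2 E) :
    ⟪mulOp Θ f, mulOp Θ g⟫_ℂ = ⟪f, g⟫_ℂ :=
  (LinearMap.norm_map_iff_inner_map_map (mulOp Θ)).1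
    ((AddMonoidHomClass.isometry_iff_norm _).1 hΘ) f g

theorem IsInner.exists_linearSymbol {Θ : HInfty E F} (hΘ : IsInner Θ) (A : F →L[ℂ] F)
    (h : ∀ f, ∃ g, mulOp Θ g = mulOp (linearSymbol A) (mulOp Θ f)) :
    ∃ B : E →L[ℂ] E, ∀ z ∈ ball (0 : ℂ) 1,
      (linearSymbol A z) ∘L (Θ z) = (Θ z) ∘L (linearSymbol B z) := by
  let X : H2 E →L[ℂ] H2 E := adjoint (mulOp Θ) ∘L mulOp (linearSymbol A) ∘L mulOp Θ
  have hXΘ : ∀ f, mulOp Θ (X f) = mulOp (linearSymbol A) (mulOp Θ f) := by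
    intro f
    obtain ⟨g, hg⟩ := h f
    -- This is `M_Θ^* M_Θ = 1`; invariance supplies the `g` that makes the compression an exact
    -- intertwiner.
    have : X f = g := ext_inner_right ℂ fun k => by
      simp only [X, comp_apply, ← hg, adjoint_inner_left, hΘ.inner_mulOp]
    rw [this, hg]
  obtain ⟨B, hB⟩ := exists_eval_single_zero_eq_linearSymbol X
    (fun f => hΘ.injective (by rw [hXΘ, mulOp_shift, mulOp_shift, mulOp_shift, hXΘ]))
    (fun f g => by
      rw [← hΘ.inner_mulOp, hXΘ, inner_mulOp_linearSymbol, ← mulOp_shift, ← hXΘ, hΘ.inner_mulOp])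
  refine ⟨B, fun z hz => ContinuousLinearMap.ext fun e => ?_⟩
  have := congrArg (eval · z) (hXΘ (lp.single 2 0 e))
  simp only [eval_mulOp _ _ hz, hB, eval_single_zero] at this
  exact this.symm

theorem IsInner.eq_of_comp_linearSymbol_eq {Θ : HInfty E F} (hΘ : IsInner Θ) {B C : E →L[ℂ] E}
    (h : ∀ z ∈ ball (0 : ℂ) 1, (Θ z) ∘L (linearSymbol B z) = (Θ z) ∘L (linearSymbol C z)) :
    B = C := by
  ext e
  have h1 : mulOp (linearSymbol B) (lp.single 2 0 e) = mulOp (linearSymbol C) (lp.single 2 0 e) :=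
    hΘ.injective <| ext_eval fun z hz => by
      simpa only [eval_mulOp _ _ hz, eval_single_zero, comp_apply] using DFunLike.congr_fun (h z hz) e
  -- At `z = 0` only the constant terms `B` and `C` survive.
  have h2 := congrArg (eval · 0) h1
  simpa [eval_mulOp _ _ (mem_ball_self one_pos), eval_single_zero, linearSymbol] using h2

end OperatorHardy

theorem mainTheorem2 {E F : Type*}
    [NormedAddCommGroup E] [InnerProductSpace ℂ E] [CompleteSpace E]
    [NormedAddCommGroup F] [InnerProductSpace ℂ F] [CompleteSpace F]
    (Θ : OperatorHardy.HInfty E F) (hΘ : OperatorHardy.IsInner Θ)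
    (S : Submodule ℂ (OperatorHardy.H2 F))
    (hS : S = LinearMap.range (OperatorHardy.mulOp Θ).toLinearMap) (hS0 : S ≠ ⊥)
    (A : F →L[ℂ] F) :
    (∀ f ∈ S, OperatorHardy.mulOp (OperatorHardy.linearSymbol A) f ∈ S) ↔
      ∃! B : E →L[ℂ] E, ∀ z ∈ Metric.ball (0 : ℂ) 1,
        (OperatorHardy.linearSymbol A z) ∘L (Θ z) = (Θ z) ∘L (OperatorHardy.linearSymbol B z) := by
  subst hS
  constructor
  · intro h
    obtain ⟨B, hB⟩ := hΘ.exists_linearSymbol A fun f => h _ ⟨f, rfl⟩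
    exact ⟨B, hB, fun C hC => hΘ.eq_of_comp_linearSymbol_eq fun z hz =>
      (hC z hz).symm.trans (hB z hz)⟩
  · rintro ⟨B, hB, -⟩ _ ⟨f, rfl⟩
    -- The factorization, applied to the vector `f(z)`, exhibits the preimage under `M_Θ`.
    refine ⟨OperatorHardy.mulOp (OperatorHardy.linearSymbol B) f,
      OperatorHardy.ext_eval fun z hz => ?_⟩
    have := DFunLike.congr_fun (hB z hz) (OperatorHardy.eval f z)
    simpa [OperatorHardy.eval_mulOp _ _ hz] using this.symm
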